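/- Let $R$ be a unital ring and let $M$ be a right $R$-module of projective dimension at most $1$. All modules below are right $R$-modules. For $n\ge 0$, a module is called $FP_n$ if it has a projective resolution which is finitely generated in every degree $\le n$ (so $FP_1$ means finitely presented). A module $M$ is called an fp-$\Omega^1$-module if it has a projective resolution $\cdots\to P_2\to P_1\xrightarrow{\alpha_1}P_0\to M\to 0$ such that the first syzygy $\operatorname{Im}(\alpha_1)$ is finitely presented. The following are equivalent: 1. $M$ is an fp-$\Omega^1$-module. 2. There is a projective module $L$ such that $M\oplus L$ is isomorphic to the direct sum of an $FP_2$-module and a projective module. 3. There is a projective module $L$ such that $M\oplus L$ is isomorphic to the direct sum of an $FP_1$-module and a projective module. 4. $\operatorname{Ext}^1_R(M,-)$ commutes with direct limits, that is, for every direct system $(M_i,\upsilon_{ij})$ of modules over a non-empty directed set, the canonical homomorphism $\varinjlim\operatorname{Ext}^1_R(M,M_i)\to\operatorname{Ext}^1_R(M,\varinjlim M_i)$ is an isomorphism. 5. $\operatorname{Ext}^1_R(M,-)$ commutes with direct sums of copies of $R$, that is, for every set $I$ the canonical homomorphism $\bigoplus_{i\in I}\operatorname{Ext}^1_R(M,R)\to\operatorname{Ext}^1_R(M,\bigoplus_{i\in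 I}R)$, induced by the inclusions $R\to\bigoplus_{i\in I}R$, is an isomorphism. -/

import Mathlib

universe u

open CategoryTheory

namespace ExtColim

/-! Left modules over `S`; right `R`-modules are the case `S = Rᵐᵒᵖ`. All modules and all index
sets live in the same universe as the ring. -/

section Finiteness

variable (S : Type u) [Ring S] (M : Type u) [AddCommGroup M] [Module S M]

/-- `M` is `FP_n`: it has a projective resolution that is finitely generated in each degree
at most `n`. -/
def IsFP (n : ℕ) : Prop :=
  ∃ P : ProjectiveResolution (ModuleCat.of S M), ∀ i ≤ n, Module.Finite S (P.complex.X i)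

/-- `M` is an fp-`Ω¹`-module: it has a projective resolution whose first syzygy, the image of
`P₁ → P₀`, is finitely presented. -/
def IsFpOmegaOne : Prop :=
  ∃ P : ProjectiveResolution (ModuleCat.of S M),
    Module.FinitePresentation S (LinearMap.range (P.complex.d 1 0).hom)

/-- For some projective module `L`, the module `M ⊕ L` is isomorphic to the direct sum of an
`FP_n`-module `F` and a projective module `U`. -/
def IsStablyFPPlusProjective (n : ℕ) : Prop :=
  ∃ (L : Type u) (_ : AddCommGroup L) (_ : Module S L)
    (F : Type u) (_ : AddCommGroup F) (_ : Module S F)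
    (U : Type u) (_ : AddCommGroup U) (_ : Module S U),
    Module.Projective S L ∧ IsFP S F n ∧ Module.Projective S U ∧
      Nonempty ((M × L) ≃ₗ[S] (F × U))

end Finiteness

section Ext

variable (S : Type u) [Ring S] (M : Type u) [AddCommGroup M] [Module S M]

/-- The group `Ext_S^n(M, X)`. -/
abbrev ExtGroup (n : ℕ) (X : Type u) [AddCommGroup X] [Module S X] : Type u :=
  Abelian.Ext (ModuleCat.of S M) (ModuleCat.of S X) n

/-- The homomorphism `Ext_S^n(M, f)`. -/
noncomputable def extMap (n : ℕ) {X Y : Type u} [AddCommGroup X] [Module S X]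
    [AddCommGroup Y] [Module S Y] (f : X →ₗ[S] Y) : ExtGroup S M n X →+ ExtGroup S M n Y :=
  (Abelian.Ext.mk₀ (ModuleCat.ofHom f)).postcomp (ModuleCat.of S M) (add_zero n)

theorem extMap_extMap (n : ℕ) {X Y Z : Type u} [AddCommGroup X] [Module S X]
    [AddCommGroup Y] [Module S Y] [AddCommGroup Z] [Module S Z]
    (f : X →ₗ[S] Y) (g : Y →ₗ[S] Z) (x : ExtGroup S M n X) :
    extMap S M n g (extMap S M n f x) = extMap S M n (g ∘ₗ f) x := by
  change (x.comp (Abelian.Ext.mk₀ (ModuleCat.ofHom f)) (add_zero n)).comp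
      (Abelian.Ext.mk₀ (ModuleCat.ofHom g)) (add_zero n) =
    x.comp (Abelian.Ext.mk₀ (ModuleCat.ofHom f ≫ ModuleCat.ofHom g)) (add_zero n)
  rw [← Abelian.Ext.mk₀_comp_mk₀]
  exact Abelian.Ext.comp_assoc _ _ _ _ _ (by simp)

/-- The canonical homomorphism `⨁ i, Ext_S^n(M, X i) → Ext_S^n(M, ⨁ i, X i)` induced by the
inclusions `X i → ⨁ i, X i`. -/
noncomputable def extDirectSumMap (n : ℕ) {I : Type u} [DecidableEq I] (X : I → Type u)
    [∀ i, AddCommGroup (X i)] [∀ i, Module S (X i)] :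
    (DirectSum I fun i => ExtGroup S M n (X i)) →+ ExtGroup S M n (DirectSum I X) :=
  DirectSum.toAddMonoid fun i => extMap S M n (DirectSum.lof S I X i)

/-- The canonical homomorphism `lim Ext_S^n(M, X i) → Ext_S^n(M, lim X i)` induced by the
canonical maps `X i → lim X i`, for a direct system `(X i, v i j)`. -/
noncomputable def extDirectLimitMap (n : ℕ) {I : Type u} [Preorder I] [DecidableEq I]
    (X : I → Type u) [∀ i, AddCommGroup (X i)] [∀ i, Module S (X i)]
    (v : ∀ i j, i ≤ j → X i →ₗ[S] X j) :
    AddCommGroup.DirectLimit (fun i => ExtGroup S M n (X i))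
        (fun i j h => extMap S M n (v i j h)) →+
      ExtGroup S M n (Module.DirectLimit X v) :=
  AddCommGroup.DirectLimit.lift _ _ _
    (fun i => extMap S M n (Module.DirectLimit.of S I X v i))
    (fun i j h x => by
      rw [extMap_extMap]
      congr 1
      congr 1
      ext y
      exact Module.DirectLimit.of_f)

/-- `Ext_S^n(M, -)` commutes with direct limits: the canonical homomorphism is an isomorphism for
every direct system of modules over a nonempty directed set. -/
def ExtCommutesWithDirectLimits (n : ℕ) : Prop :=
  ∀ (I : Type u) [Preorder I] [IsDirectedOrder I] [Nonempty I] [DecidableEq I]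
    (X : I → Type u) [∀ i, AddCommGroup (X i)] [∀ i, Module S (X i)]
    (v : ∀ i j, i ≤ j → X i →ₗ[S] X j) [DirectedSystem X fun i j h => v i j h],
    Function.Bijective (extDirectLimitMap S M n X v)

/-- `Ext_S^n(M, -)` commutes with direct sums of copies of a module `A`: the canonical homomorphism
is an isomorphism for every constant family with value `A`. -/
def ExtCommutesWithDirectSumsOfCopies (n : ℕ) (A : Type u) [AddCommGroup A] [Module S A] : Prop :=
  ∀ (I : Type u) [DecidableEq I], Function.Bijective (extDirectSumMap S M n fun _ : I => A)

end Ext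

end ExtColim

/-! Everything passes through one condition, `HasFiniteProjectiveSyzygy`: `M = P/K` with `P`
projective and `K` finitely generated projective. Since `M` has projective dimension at most 1, the
kernel `K` of any surjection `p : P → M` from a projective is projective, and `Ext¹(M, X)` is
`Hom(K, X)` modulo the maps that extend to `P`. So the question is when `K` can be made finitely
generated.

If it can, embed `P` as a summand of a free module `E`. Then `K` lies in a finitely generated free
summand of `E`, and computing `E/K` in two ways gives the stable decomposition. Also, maps from `K`
to a direct limit factor through a term, which makes `Ext¹(M, -)` commute with direct limits.
Conversely, a stable decomposition yields such a `P` as the preimage of `M` in a projective cover of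
the sum by a surjection.

The main step is the return from direct sums of copies of the ring (`exists_extension`,
`of_extension`). The class of a split embedding `s : K → S^(K)` comes from a finite subsum, so off
finitely many coordinates `s` extends to `P`. The extension cuts out a projective submodule of `P ⊕
L`, with `K ⊕ L` free, that still maps onto `M` but with finitely generated kernel. -/

namespace ExtColim

/-! ### Resolutions of length one -/

section Resolution

variable {S : Type u} [Ring S] {M P : Type u} [AddCommGroup M] [Module S M]
  [AddCommGroup P] [Module S P]

/-- The terms of the complex `⋯ → 0 → 0 → ker p → P`. -/
def twoTermX (p : P →ₗ[S] M) : ℕ → ModuleCat.{u} S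
  | 0 => ModuleCat.of S P
  | 1 => ModuleCat.of S (LinearMap.ker p)
  | _ + 2 => ModuleCat.of S (PUnit : Type u)

/-- The differentials of the complex `⋯ → 0 → 0 → ker p → P`. -/
def twoTermD (p : P →ₗ[S] M) : ∀ n, twoTermX p (n + 1) ⟶ twoTermX p n
  | 0 => ModuleCat.ofHom (LinearMap.ker p).subtype
  | _ + 1 => 0

/-- The complex `⋯ → 0 → 0 → ker p → P`. -/
noncomputable def twoTerm (p : P →ₗ[S] M) : ChainComplex (ModuleCat.{u} S) ℕ :=
  ChainComplex.of (twoTermX p) (twoTermD p) fun _ => Limits.zero_comp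

theorem twoTerm_d_one_zero (p : P →ₗ[S] M) :
    (twoTerm p).d 1 0 = ModuleCat.ofHom (LinearMap.ker p).subtype :=
  ChainComplex.of_d (twoTermX p) (twoTermD p) 0

/-- The augmentation of the complex `⋯ → 0 → 0 → ker p → P`. -/
noncomputable def twoTermπ (p : P →ₗ[S] M) :
    twoTerm p ⟶ (ChainComplex.single₀ (ModuleCat.{u} S)).obj (ModuleCat.of S M) :=
  (ChainComplex.toSingle₀Equiv (twoTerm p) (ModuleCat.of S M)).symm
    ⟨ModuleCat.ofHom p, by
      rw [twoTerm_d_one_zero]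
      ext x
      exact x.2⟩

theorem quasiIso_twoTermπ (p : P →ₗ[S] M) (hp : Function.Surjective p) :
    QuasiIso (twoTermπ p) where
  quasiIsoAt n := by
    match n with
    | 0 =>
      rw [ChainComplex.quasiIsoAt₀_iff, ShortComplex.quasiIso_iff_of_zeros' _ rfl rfl rfl]
      have h := LinearMap.shortExact_shortComplexKer hp
      refine (ShortComplex.exact_and_epi_g_iff_of_iso ?_).2 ⟨h.exact, h.epi_g⟩
      refine ShortComplex.isoMk (Iso.refl _) (Iso.refl _) (Iso.refl _) ?_ ?_
      · exact (Category.id_comp _).trans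
          ((twoTerm_d_one_zero p).symm.trans (Category.comp_id _).symm)
      · have h0 : (twoTermπ p).f 0 = ModuleCat.ofHom p :=
          ChainComplex.toSingle₀Equiv_symm_apply_f_zero _ _
        exact (Category.id_comp _).trans (h0.symm.trans (Category.comp_id ((twoTermπ p).f 0)).symm)
    | n + 1 =>
      rw [quasiIsoAt_iff_exactAt' (hL := ChainComplex.exactAt_succ_single_obj ..),
        HomologicalComplex.exactAt_iff' _ (n + 2) (n + 1) n (by simp) (by simp)]
      -- Exactness in degree 1 is injectivity of `ker p → P`; in higher degrees the term is zero.
      match n with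
      | 0 =>
        refine (ShortComplex.exact_iff_mono _ ?_).2 ?_
        · exact ChainComplex.of_d (twoTermX p) (twoTermD p) 1
        · change Mono ((twoTerm p).d 1 0)
          rw [twoTerm_d_one_zero]
          exact (ModuleCat.mono_iff_injective _).2 (LinearMap.ker p).injective_subtype
      | n + 1 =>
        apply ShortComplex.exact_of_isZero_X₂
        exact ModuleCat.isZero_of_subsingleton (ModuleCat.of S (PUnit : Type u))

/-- The projective resolution `⋯ → 0 → 0 → ker p → P` of `M` given by a surjection `p : P → M`
from a projective module whose kernel is projective. -/
noncomputable def twoTermResolution (p : P →ₗ[S] M) (hp : Function.Surjective p)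
    [Module.Projective S P] [Module.Projective S (LinearMap.ker p)] :
    ProjectiveResolution (ModuleCat.of S M) where
  complex := twoTerm p
  projective n := by
    match n with
    | 0 => exact (IsProjective.iff_projective P).1 inferInstance
    | 1 => exact (IsProjective.iff_projective (LinearMap.ker p)).1 inferInstance
    | n + 2 => exact (IsProjective.iff_projective (PUnit : Type u)).1 inferInstance
  π := twoTermπ p
  quasiIso := quasiIso_twoTermπ p hp

theorem isFP_of_surjective (p : P →ₗ[S] M) (hp : Function.Surjective p)
    [Module.Projective S P] [Module.Projective S (LinearMap.ker p)]
    [Module.Finite S P] [Module.Finite S (LinearMap.ker p)] (n : ℕ) : IsFP S M n :=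
  ⟨twoTermResolution p hp, fun i _ => by
    match i with
    | 0 => exact inferInstanceAs (Module.Finite S P)
    | 1 => exact inferInstanceAs (Module.Finite S (LinearMap.ker p))
    | i + 2 => exact inferInstanceAs (Module.Finite S (PUnit : Type u))⟩

theorem isFpOmegaOne_of_surjective (p : P →ₗ[S] M) (hp : Function.Surjective p)
    [Module.Projective S P] [Module.Projective S (LinearMap.ker p)]
    [Module.Finite S (LinearMap.ker p)] : IsFpOmegaOne S M := by
  refine ⟨twoTermResolution p hp, ?_⟩
  change Module.FinitePresentation S (LinearMap.range ((twoTerm p).d 1 0).hom)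
  rw [twoTerm_d_one_zero]
  have : Module.FinitePresentation S (LinearMap.range (LinearMap.ker p).subtype) := by
    rw [Submodule.range_subtype]
    exact Module.finitePresentation_of_projective S _
  exact this

theorem projectiveResolution_surjective_π (Q : ProjectiveResolution (ModuleCat.of S M)) :
    Function.Surjective (Q.π.f 0).hom :=
  (ModuleCat.epi_iff_surjective _).1 inferInstance

theorem projectiveResolution_range_d (Q : ProjectiveResolution (ModuleCat.of S M)) :
    LinearMap.range (Q.complex.d 1 0).hom = LinearMap.ker (Q.π.f 0).hom :=
  ((ShortComplex.mk _ _ Q.complex_d_comp_π_f_zero).exact_of_g_is_cokernel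
    Q.isColimitCokernelCofork).moduleCat_range_eq_ker

/-- Dimension shifting along `0 → ker p → P → M → 0`. -/
theorem projective_ker_of_hasProjectiveDimensionLE
    (hM : HasProjectiveDimensionLE (ModuleCat.of S M) 1) (p : P →ₗ[S] M)
    (hp : Function.Surjective p) [Module.Projective S P] :
    Module.Projective S (LinearMap.ker p) := by
  rw [IsProjective.iff_projective, projective_iff_hasProjectiveDimensionLT_one]
  have hP : Projective (ModuleCat.of S P) := (IsProjective.iff_projective P).1 inferInstance
  exact ((LinearMap.shortExact_shortComplexKer hp).hasProjectiveDimensionLT_X₃_iff 0 hP).1 hM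

end Resolution

/-! ### `Ext¹` as a quotient of `Hom(ker p, -)` -/

section Connecting

variable {S : Type u} [Ring S] {M P : Type u} [AddCommGroup M] [Module S M]
  [AddCommGroup P] [Module S P] {p : P →ₗ[S] M} (hp : Function.Surjective p)
  {X Y : Type u} [AddCommGroup X] [Module S X] [AddCommGroup Y] [Module S Y]

/-- The connecting map `Hom(ker p, X) → Ext¹(M, X)` of a surjection `p : P → M`. -/
noncomputable def connecting (f : LinearMap.ker p →ₗ[S] X) : ExtGroup S M 1 X :=
  (LinearMap.shortExact_shortComplexKer hp).extClass.comp
    (Abelian.Ext.mk₀ (ModuleCat.ofHom f)) (add_zero 1)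

theorem extMap_connecting (f : LinearMap.ker p →ₗ[S] X) (g : X →ₗ[S] Y) :
    extMap S M 1 g (connecting hp f) = connecting hp (g ∘ₗ f) := by
  change ((LinearMap.shortExact_shortComplexKer hp).extClass.comp
      (Abelian.Ext.mk₀ (ModuleCat.ofHom f)) (add_zero 1)).comp
      (Abelian.Ext.mk₀ (ModuleCat.ofHom g)) (add_zero 1) =
    (LinearMap.shortExact_shortComplexKer hp).extClass.comp
      (Abelian.Ext.mk₀ (ModuleCat.ofHom f ≫ ModuleCat.ofHom g)) (add_zero 1)
  rw [← Abelian.Ext.mk₀_comp_mk₀]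
  exact Abelian.Ext.comp_assoc _ _ _ _ _ (by simp)

/-- The obstruction lies in `Ext¹(P, X)`, which vanishes for projective `P`. -/
theorem connecting_surjective [Module.Projective S P] (x : ExtGroup S M 1 X) :
    ∃ f : LinearMap.ker p →ₗ[S] X, connecting hp f = x := by
  have hP : Projective (ModuleCat.of S P) := (IsProjective.iff_projective P).1 inferInstance
  obtain ⟨y, hy⟩ := Abelian.Ext.contravariant_sequence_exact₃
    (LinearMap.shortExact_shortComplexKer hp) (ModuleCat.of S X) x
    (Abelian.Ext.eq_zero_of_hasProjectiveDimensionLT _ 1 le_rfl) (n₀ := 0) rfl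
  obtain ⟨f, rfl⟩ := (Abelian.Ext.mk₀_bijective _ _).2 y
  exact ⟨f.hom, hy⟩

theorem connecting_eq_zero_iff (f : LinearMap.ker p →ₗ[S] X) :
    connecting hp f = 0 ↔ ∃ h : P →ₗ[S] X, h ∘ₗ (LinearMap.ker p).subtype = f := by
  constructor
  · intro h0
    obtain ⟨y, hy⟩ := Abelian.Ext.contravariant_sequence_exact₁
      (LinearMap.shortExact_shortComplexKer hp) (ModuleCat.of S X)
      (Abelian.Ext.mk₀ (ModuleCat.ofHom f)) rfl h0
    obtain ⟨h, rfl⟩ := (Abelian.Ext.mk₀_bijective _ _).2 y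
    rw [Abelian.Ext.mk₀_comp_mk₀] at hy
    exact ⟨h.hom, congrArg ModuleCat.Hom.hom ((Abelian.Ext.mk₀_bijective _ _).1 hy)⟩
  · rintro ⟨h, rfl⟩
    change (LinearMap.shortExact_shortComplexKer hp).extClass.comp
      (Abelian.Ext.mk₀ (ModuleCat.ofHom (LinearMap.ker p).subtype ≫ ModuleCat.ofHom h))
      (add_zero 1) = 0
    rw [← Abelian.Ext.mk₀_comp_mk₀]
    exact (LinearMap.shortExact_shortComplexKer hp).extClass_comp_assoc _

theorem connecting_add (f g : LinearMap.ker p →ₗ[S] X) :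
    connecting hp (f + g) = connecting hp f + connecting hp g := by
  change (LinearMap.shortExact_shortComplexKer hp).extClass.comp
    (Abelian.Ext.mk₀ (ModuleCat.ofHom f + ModuleCat.ofHom g)) (add_zero 1) = _
  rw [Abelian.Ext.mk₀_add, Abelian.Ext.comp_add]
  rfl

end Connecting

/-! ### Finitely generated projective syzygies and stable decompositions -/

section Presentation

variable (S : Type u) [Ring S] (M : Type u) [AddCommGroup M] [Module S M]

/-- `M` is the quotient of a projective module by a finitely generated projective submodule. -/
def HasFiniteProjectiveSyzygy : Prop :=
  ∃ (P : Type u) (_ : AddCommGroup P) (_ : Module S P) (p : P →ₗ[S] M),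
    Module.Projective S P ∧ Function.Surjective p ∧
      Module.Projective S (LinearMap.ker p) ∧ Module.Finite S (LinearMap.ker p)

variable {S M}

theorem HasFiniteProjectiveSyzygy.isFpOmegaOne (h : HasFiniteProjectiveSyzygy S M) :
    IsFpOmegaOne S M := by
  obtain ⟨P, _, _, p, _, hp, _, _⟩ := h
  exact isFpOmegaOne_of_surjective p hp

theorem HasFiniteProjectiveSyzygy.of_isFpOmegaOne
    (hM : HasProjectiveDimensionLE (ModuleCat.of S M) 1) (h : IsFpOmegaOne S M) :
    HasFiniteProjectiveSyzygy S M := by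
  obtain ⟨Q, hQ⟩ := h
  have hQ0 : Module.Projective S (Q.complex.X 0) :=
    (IsProjective.iff_projective (Q.complex.X 0)).2 (Q.projective 0)
  refine ⟨Q.complex.X 0, inferInstance, inferInstance, (Q.π.f 0).hom, hQ0,
    projectiveResolution_surjective_π Q,
    projective_ker_of_hasProjectiveDimensionLE hM (Q.π.f 0).hom
      (projectiveResolution_surjective_π Q), ?_⟩
  have : Module.Finite S (LinearMap.range (Q.complex.d 1 0).hom) := inferInstance
  exact Module.Finite.equiv (LinearEquiv.ofEq _ _ (projectiveResolution_range_d Q))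

theorem isStablyFPPlusProjective_mono {m n : ℕ} (hmn : m ≤ n)
    (h : IsStablyFPPlusProjective S M n) : IsStablyFPPlusProjective S M m := by
  obtain ⟨L, _, _, F, _, _, U, _, _, hL, ⟨Q, hQ⟩, hU, he⟩ := h
  exact ⟨L, _, _, F, _, _, U, _, _, hL, ⟨Q, fun i hi => hQ i (hi.trans hmn)⟩, hU, he⟩

theorem projective_ker_of_projective {P L : Type u} [AddCommGroup P] [Module S P]
    [AddCommGroup L] [Module S L] [Module.Projective S P] [Module.Projective S L]
    (f : P →ₗ[S] L) (hf : Function.Surjective f) : Module.Projective S (LinearMap.ker f) := by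
  obtain ⟨g, hg⟩ := Module.projective_lifting_property f LinearMap.id hf
  have hg' : ∀ x, f (g x) = x := fun x => LinearMap.congr_fun hg x
  refine Module.Projective.of_split (LinearMap.ker f).subtype
    ((LinearMap.id - g ∘ₗ f).codRestrict (LinearMap.ker f) fun x => by simp [hg']) ?_
  ext x
  simp

/-- With `Q` resolving `F`, the projective `Q₀ × U` maps onto `M × L`. The preimage of `M × 0` is a
direct summand, because `L` is projective, and it maps onto `M` with the same kernel, namely the
image of `Q₁`. -/
theorem HasFiniteProjectiveSyzygy.of_isStablyFPPlusProjective
    (hM : HasProjectiveDimensionLE (ModuleCat.of S M) 1) (h : IsStablyFPPlusProjective S M 1) :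
    HasFiniteProjectiveSyzygy S M := by
  obtain ⟨L, _, _, F, _, _, U, _, _, _, ⟨Q, hQ⟩, _, ⟨e⟩⟩ := h
  have hQ0 : Module.Projective S (Q.complex.X 0) :=
    (IsProjective.iff_projective (Q.complex.X 0)).2 (Q.projective 0)
  have hQ1 : Module.Finite S (Q.complex.X 1) := hQ 1 le_rfl
  set π : Q.complex.X 0 →ₗ[S] F := (Q.π.f 0).hom with hπ
  have hπs : Function.Surjective π := projectiveResolution_surjective_π Q
  set d : Q.complex.X 1 →ₗ[S] Q.complex.X 0 := (Q.complex.d 1 0).hom with hd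
  have hr : LinearMap.range d = LinearMap.ker π := projectiveResolution_range_d Q
  let g : (Q.complex.X 0 × U) →ₗ[S] M × L := e.symm.toLinearMap ∘ₗ π.prodMap LinearMap.id
  have hg : Function.Surjective g :=
    e.symm.surjective.comp (hπs.prodMap Function.surjective_id)
  have hg0 : ∀ z, g z = 0 ↔ π z.1 = 0 ∧ z.2 = 0 := fun z => by
    simp [g, Prod.ext_iff]
  let q : (Q.complex.X 0 × U) →ₗ[S] L := LinearMap.snd S M L ∘ₗ g
  have hq : Function.Surjective q := Prod.snd_surjective.comp hg
  let p : LinearMap.ker q →ₗ[S] M := LinearMap.fst S M L ∘ₗ g ∘ₗ (LinearMap.ker q).subtype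
  have hp : Function.Surjective p := fun m => by
    obtain ⟨z, hz⟩ := hg (m, 0)
    exact ⟨⟨z, by simp [q, hz]⟩, by simp [p, hz]⟩
  have hproj : Module.Projective S (LinearMap.ker q) := projective_ker_of_projective q hq
  refine ⟨LinearMap.ker q, inferInstance, inferInstance, p, hproj, hp,
    projective_ker_of_hasProjectiveDimensionLE hM p hp, ?_⟩
  have hd0 : ∀ x, g (d x, 0) = 0 := fun x =>
    (hg0 _).2 ⟨LinearMap.mem_ker.1 (hr ▸ LinearMap.mem_range_self d x), rfl⟩
  let t : Q.complex.X 1 →ₗ[S] LinearMap.ker p :=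
    ((LinearMap.inl S _ U ∘ₗ d).codRestrict (LinearMap.ker q) fun x => by
      simp [q, hd0]).codRestrict (LinearMap.ker p) fun x => congrArg Prod.fst (hd0 x)
  refine Module.Finite.of_surjective t ?_
  rintro ⟨⟨z, hz⟩, hz'⟩
  have hz0 : g z = 0 := Prod.ext hz' hz
  obtain ⟨h1, h2⟩ := (hg0 z).1 hz0
  obtain ⟨x, hx⟩ : z.1 ∈ LinearMap.range d := hr ▸ LinearMap.mem_ker.2 h1
  refine ⟨x, Subtype.ext (Subtype.ext (Prod.ext hx h2.symm))⟩

/-- A finitely generated submodule of a free module is supported on a finite set. -/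
theorem exists_finset_le_supported {ι A : Type*} [AddCommGroup A] [Module S A]
    {N : Submodule S (ι →₀ A)} (hN : N.FG) :
    ∃ J : Finset ι, N ≤ Finsupp.supported A S (J : Set ι) := by
  classical
  obtain ⟨T, rfl⟩ := hN
  refine ⟨T.biUnion Finsupp.support, Submodule.span_le.2 fun x hx => ?_⟩
  exact (Finsupp.mem_supported S x).2 (mod_cast Finset.subset_biUnion_of_mem Finsupp.support hx)

/-- The quotient `E / s(ker p)` is computed twice: as `M × ker π` through the splitting of `π`, and
as `(G / a(ker p)) × U` because `s(ker p)` lies in the factor `G`. The module `G / a(ker p)` is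
resolved by `0 → ker p → G`, so it is `FP_n` for every `n`. -/
theorem isStablyFPPlusProjective_of_prod {E G U P : Type u} [AddCommGroup E] [Module S E]
    [AddCommGroup G] [Module S G] [AddCommGroup U] [Module S U] [AddCommGroup P] [Module S P]
    [Module.Projective S G] [Module.Finite S G] [Module.Projective S U]
    (e : E ≃ₗ[S] G × U) (π : E →ₗ[S] P) (s : P →ₗ[S] E) (hs' : ∀ x, π (s x) = x)
    (p : P →ₗ[S] M) (hp : Function.Surjective p)
    [Module.Projective S P] [Module.Projective S (LinearMap.ker p)]
    [Module.Finite S (LinearMap.ker p)]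
    (he2 : ∀ x ∈ LinearMap.ker p, (e (s x)).2 = 0) (n : ℕ) : IsStablyFPPlusProjective S M n := by
  have hE : Module.Projective S E := Module.Projective.of_equiv e.symm
  let a : LinearMap.ker p →ₗ[S] G :=
    LinearMap.fst S _ _ ∘ₗ e.toLinearMap ∘ₗ s ∘ₗ (LinearMap.ker p).subtype
  have hea : ∀ x : LinearMap.ker p, e (s x) = (a x, 0) := fun x => Prod.ext rfl (he2 x x.2)
  have ha : Function.Injective a := fun x y hxy => by
    have := e.injective ((hea x).trans ((congrArg (·, 0) hxy).trans (hea y).symm))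
    apply Subtype.ext
    rw [← hs' x, ← hs' y, this]
  have hFker : LinearMap.ker (LinearMap.range a).mkQ = LinearMap.range a :=
    Submodule.ker_mkQ _
  let ea : LinearMap.ker p ≃ₗ[S] LinearMap.ker (LinearMap.range a).mkQ :=
    (LinearEquiv.ofInjective a ha).trans (LinearEquiv.ofEq _ _ hFker.symm)
  have : Module.Projective S (LinearMap.ker (LinearMap.range a).mkQ) :=
    Module.Projective.of_equiv ea
  have : Module.Finite S (LinearMap.ker (LinearMap.range a).mkQ) := Module.Finite.equiv ea
  have hFP : IsFP S (G ⧸ LinearMap.range a) n :=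
    isFP_of_surjective (LinearMap.range a).mkQ (Submodule.mkQ_surjective _) n
  let f : E →ₗ[S] M × LinearMap.ker π :=
    (p ∘ₗ π).prod ((LinearMap.id - s ∘ₗ π).codRestrict (LinearMap.ker π) fun x => by
      simp [hs'])
  have hf : Function.Surjective f := by
    rintro ⟨m, l, hl⟩
    obtain ⟨y, rfl⟩ := hp m
    have hl' : π l = 0 := hl
    refine ⟨s y + l, Prod.ext ?_ (Subtype.ext ?_)⟩
    · simp [f, hs', hl']
    · simp [f, hs', hl']
  let g : E →ₗ[S] (G ⧸ LinearMap.range a) × U :=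
    (LinearMap.range a).mkQ.prodMap LinearMap.id ∘ₗ e.toLinearMap
  have hg : Function.Surjective g :=
    ((Submodule.mkQ_surjective _).prodMap Function.surjective_id).comp e.surjective
  have hfg : LinearMap.ker f = LinearMap.ker g := by
    ext x
    have h1 : x ∈ LinearMap.ker f ↔ p (π x) = 0 ∧ x - s (π x) = 0 := by
      simp [f, LinearMap.ker_prod]
    have h2 : x ∈ LinearMap.ker g ↔ (e x).1 ∈ LinearMap.range a ∧ (e x).2 = 0 := by
      simp [g, Prod.ext_iff]
    rw [h1, h2, sub_eq_zero]
    constructor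
    · rintro ⟨h3, h4⟩
      have h5 := hea ⟨π x, h3⟩
      change e (s (π x)) = _ at h5
      rw [← h4] at h5
      exact ⟨⟨_, (congrArg Prod.fst h5).symm⟩, congrArg Prod.snd h5⟩
    · rintro ⟨⟨y, hy⟩, h4⟩
      have h5 : x = s y := e.injective
        ((Prod.ext hy.symm h4 : e x = (a y, 0)).trans (hea y).symm)
      rw [h5, hs']
      exact ⟨y.2, rfl⟩
  have hπs : Function.Surjective π := fun x => ⟨s x, hs' x⟩
  exact ⟨LinearMap.ker π, _, _, G ⧸ LinearMap.range a, _, _, U, _, _, projective_ker_of_projective π hπs, hFP,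
    inferInstance,
    ⟨(f.quotKerEquivOfSurjective hf).symm.trans
      ((Submodule.quotEquivOfEq _ _ hfg).trans (g.quotKerEquivOfSurjective hg))⟩⟩

/-- `P` is a summand of the free module on its own elements, where the finitely generated `s(ker p)`
involves only finitely many coordinates `J`. -/
theorem HasFiniteProjectiveSyzygy.isStablyFPPlusProjective
    (h : HasFiniteProjectiveSyzygy S M) (n : ℕ) : IsStablyFPPlusProjective S M n := by
  classical
  obtain ⟨P, _, _, p, _, hp, _, hfin⟩ := h
  obtain ⟨s, hs⟩ := Module.projective_def'.1 (inferInstance : Module.Projective S P)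
  set π : (P →₀ S) →ₗ[S] P := Finsupp.linearCombination S id with hπ
  have hs' : ∀ x, π (s x) = x := fun x => LinearMap.congr_fun hs x
  obtain ⟨J, hJ⟩ := exists_finset_le_supported
    (((Module.Finite.iff_fg).1 hfin).map s)
  let e : (P →₀ S) ≃ₗ[S] ((J : Set P) →₀ S) × (((J : Set P)ᶜ : Set P) →₀ S) :=
    (Finsupp.domLCongr (Equiv.Set.sumCompl (J : Set P)).symm).trans
      (Finsupp.sumFinsuppLEquivProdFinsupp S)
  have he2 : ∀ x ∈ LinearMap.ker p, (e (s x)).2 = 0 := fun x hx => by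
    ext ⟨b, hb⟩
    have := (Finsupp.mem_supported' S (s x)).1 (hJ (Submodule.mem_map_of_mem hx)) b hb
    simp only [e, LinearEquiv.trans_apply]
    exact this
  exact isStablyFPPlusProjective_of_prod e π s hs' p hp he2 n

end Presentation

/-! ### Commutation with direct limits -/

section DirectLimit

variable {S : Type u} [Ring S] {M : Type u} [AddCommGroup M] [Module S M]

section Lift

variable {I : Type u} [Preorder I] [IsDirectedOrder I] [Nonempty I] [DecidableEq I]
  {X : I → Type u} [∀ i, AddCommGroup (X i)] [∀ i, Module S (X i)]
  {v : ∀ i j, i ≤ j → X i →ₗ[S] X j}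

theorem exists_of_eq_on_finset {ι : Type*} (x : ι → Module.DirectLimit X v) (i₀ : I)
    (J : Finset ι) :
    ∃ j, i₀ ≤ j ∧ ∃ y : ι → X j, ∀ b ∈ J, Module.DirectLimit.of S I X v j (y b) = x b := by
  classical
  induction J using Finset.induction_on with
  | empty => exact ⟨i₀, le_rfl, 0, by simp⟩
  | insert b J _ ih =>
    obtain ⟨j, hj, y, hy⟩ := ih
    obtain ⟨k, z, hz⟩ := Module.DirectLimit.exists_of (x b)
    obtain ⟨l, hjl, hkl⟩ := exists_ge_ge j k
    refine ⟨l, hj.trans hjl, fun c => if c = b then v k l hkl z else v j l hjl (y c), ?_⟩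
    intro c hc
    by_cases hcb : c = b
    · subst hcb
      simp [hz]
    · simp [hcb, hy c (Finset.mem_of_mem_insert_of_ne hc hcb)]

/-- A homomorphism from a projective module to a direct limit agrees, on a given finitely
generated submodule, with a homomorphism to some term of the system. -/
theorem exists_of_comp_eq_on_fg {P : Type u} [AddCommGroup P] [Module S P]
    [Module.Projective S P] {K : Submodule S P} (hK : K.FG)
    (h : P →ₗ[S] Module.DirectLimit X v) (i₀ : I) :
    ∃ j, i₀ ≤ j ∧ ∃ t : P →ₗ[S] X j, ∀ k ∈ K, Module.DirectLimit.of S I X v j (t k) = h k := by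
  obtain ⟨s, hs⟩ := Module.projective_def'.1 (inferInstance : Module.Projective S P)
  have hs' : ∀ x, Finsupp.linearCombination S id (s x) = x := fun x => LinearMap.congr_fun hs x
  obtain ⟨J, hJ⟩ := exists_finset_le_supported (hK.map s)
  obtain ⟨j, hj, y, hy⟩ := exists_of_eq_on_finset h i₀ J
  -- The values of `y` outside `J` are irrelevant, since `s k` is supported on `J` for `k ∈ K`.
  refine ⟨j, hj, Finsupp.linearCombination S y ∘ₗ s, fun k hk => ?_⟩
  have hsk := (Finsupp.mem_supported S _).1 (hJ (Submodule.mem_map_of_mem hk))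
  conv_rhs => rw [← hs' k]
  simp only [LinearMap.comp_apply, Finsupp.linearCombination_apply, Finsupp.sum, map_sum, map_smul]
  exact Finset.sum_congr rfl fun b hb => by rw [hy b (mod_cast hsk hb)]; rfl

-- Each generator is equalized at some stage, and directedness gives a common one.
omit [Nonempty I] in
theorem exists_map_comp_eq_of_fg [DirectedSystem X fun i j h => v i j h]
    {K : Type u} [AddCommGroup K] [Module S K] [hK : Module.Finite S K] {i : I}
    (f g : K →ₗ[S] X i)
    (hfg : ∀ k, Module.DirectLimit.of S I X v i (f k) = Module.DirectLimit.of S I X v i (g k)) :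
    ∃ j, ∃ hij : i ≤ j, v i j hij ∘ₗ f = v i j hij ∘ₗ g := by
  classical
  obtain ⟨T, hT⟩ := hK.fg_top
  suffices h : ∀ T : Finset K, ∃ j, ∃ hij : i ≤ j, ∀ k ∈ T, v i j hij (f k) = v i j hij (g k) by
    obtain ⟨j, hij, h⟩ := h T
    exact ⟨j, hij, LinearMap.ext_on hT fun k hk => h k hk⟩
  intro T
  induction T using Finset.induction_on with
  | empty => exact ⟨i, le_rfl, by simp⟩
  | insert k T _ ih =>
    obtain ⟨j, hij, h⟩ := ih
    obtain ⟨l, hil, hl⟩ := Module.DirectLimit.exists_eq_of_of_eq (hfg k)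
    obtain ⟨m, hjm, hlm⟩ := exists_ge_ge j l
    refine ⟨m, hij.trans hjm, fun k' hk' => ?_⟩
    obtain rfl | hk' := Finset.mem_insert.1 hk'
    · have := congrArg (v l m hlm) hl
      rwa [DirectedSystem.map_map' (f := v), DirectedSystem.map_map' (f := v)] at this
    · have := congrArg (v j m hjm) (h k' hk')
      rwa [DirectedSystem.map_map' (f := v), DirectedSystem.map_map' (f := v)] at this

end Lift

theorem extDirectLimitMap_of (n : ℕ) {I : Type u} [Preorder I] [DecidableEq I]
    (X : I → Type u) [∀ i, AddCommGroup (X i)] [∀ i, Module S (X i)]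
    (v : ∀ i j, i ≤ j → X i →ₗ[S] X j) (i : I) (x : ExtGroup S M n (X i)) :
    extDirectLimitMap S M n X v (AddCommGroup.DirectLimit.of _ _ i x) =
      extMap S M n (Module.DirectLimit.of S I X v i) x :=
  AddCommGroup.DirectLimit.lift_of _ _ _ _ _

theorem HasFiniteProjectiveSyzygy.extCommutesWithDirectLimits
    (h : HasFiniteProjectiveSyzygy S M) : ExtCommutesWithDirectLimits S M 1 := by
  obtain ⟨P, _, _, p, _, hp, _, hfin⟩ := h
  intro I _ _ _ _ X _ _ v _
  constructor
  · rw [injective_iff_map_eq_zero]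
    intro z
    induction z using AddCommGroup.DirectLimit.induction_on with
    | ih i x =>
      intro hx
      obtain ⟨g, rfl⟩ := connecting_surjective hp x
      rw [extDirectLimitMap_of, extMap_connecting, connecting_eq_zero_iff] at hx
      obtain ⟨f, hf⟩ := hx
      -- The extension `f` over the limit descends to `t` on `P`; on `ker p` it agrees with the
      -- given `g` only in the limit, hence at a later stage `l`.
      obtain ⟨j, hij, t, ht⟩ := exists_of_comp_eq_on_fg (Module.Finite.iff_fg.1 hfin) f i
      obtain ⟨l, hjl, hl⟩ := exists_map_comp_eq_of_fg (t ∘ₗ (LinearMap.ker p).subtype)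
        (v i j hij ∘ₗ g) fun k => by
          rw [LinearMap.comp_apply, LinearMap.comp_apply, Module.DirectLimit.of_f]
          exact (ht k k.2).trans (LinearMap.congr_fun hf k)
      rw [← AddCommGroup.DirectLimit.of_f (hij.trans hjl)]
      have h0 : extMap S M 1 (v i l (hij.trans hjl)) (connecting hp g) = 0 := by
        rw [extMap_connecting, connecting_eq_zero_iff]
        refine ⟨v j l hjl ∘ₗ t, ?_⟩
        rw [LinearMap.comp_assoc, hl]
        ext k
        exact DirectedSystem.map_map' (f := v) hij hjl (g k)
      rw [h0, map_zero]
  · intro y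
    obtain ⟨f, rfl⟩ := connecting_surjective hp y
    -- Here the projective module is `ker p` itself and the submodule is `⊤`; any starting index
    -- will do.
    obtain ⟨j, _, t, ht⟩ := exists_of_comp_eq_on_fg
      (Module.finite_def.1 hfin) f (Classical.arbitrary I)
    refine ⟨AddCommGroup.DirectLimit.of _ _ j (connecting hp t), ?_⟩
    rw [extDirectLimitMap_of, extMap_connecting]
    congr 1
    ext k
    exact ht k trivial

end DirectLimit

/-! ### From direct limits to direct sums -/

section DirectSum

variable {S : Type u} [Ring S] {M : Type u} [AddCommGroup M] [Module S M]
  {X Y : Type u} [AddCommGroup X] [Module S X] [AddCommGroup Y] [Module S Y]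

theorem extMap_add (n : ℕ) (f g : X →ₗ[S] Y) (x : ExtGroup S M n X) :
    extMap S M n (f + g) x = extMap S M n f x + extMap S M n g x := by
  change x.comp (Abelian.Ext.mk₀ (ModuleCat.ofHom f + ModuleCat.ofHom g)) (add_zero n) = _
  rw [Abelian.Ext.mk₀_add, Abelian.Ext.comp_add]
  rfl

theorem extMap_zero (n : ℕ) (x : ExtGroup S M n X) : extMap S M n (0 : X →ₗ[S] Y) x = 0 := by
  simpa using extMap_add n (0 : X →ₗ[S] Y) 0 x

theorem extMap_id (n : ℕ) (x : ExtGroup S M n X) :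
    extMap S M n (LinearMap.id : X →ₗ[S] X) x = x :=
  Abelian.Ext.comp_mk₀_id x

theorem extMap_sum (n : ℕ) {ι : Type*} (J : Finset ι) (f : ι → X →ₗ[S] Y)
    (x : ExtGroup S M n X) :
    extMap S M n (∑ i ∈ J, f i) x = ∑ i ∈ J, extMap S M n (f i) x := by
  classical
  induction J using Finset.induction_on with
  | empty => simp [extMap_zero]
  | insert i J hi ih => rw [Finset.sum_insert hi, Finset.sum_insert hi, extMap_add, ih]

section

variable {I : Type u} [DecidableEq I] (Z : I → Type u) [∀ i, AddCommGroup (Z i)]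
  [∀ i, Module S (Z i)]

theorem extDirectSumMap_of (n : ℕ) (i : I) (x : ExtGroup S M n (Z i)) :
    extDirectSumMap S M n Z (DirectSum.of _ i x) = extMap S M n (DirectSum.lof S I Z i) x :=
  DirectSum.toAddMonoid_of _ _ _

/-- Injectivity holds for every `M`: the maps induced by the projections recover the coordinates. -/
theorem extDirectSumMap_injective (n : ℕ) : Function.Injective (extDirectSumMap S M n Z) := by
  have key : ∀ (i : I) (z : DirectSum I fun i => ExtGroup S M n (Z i)),
      extMap S M n (DirectSum.component S I Z i) (extDirectSumMap S M n Z z) = z i := by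
    intro i z
    induction z using DirectSum.induction_on with
    | zero => simp
    | of j x =>
      rw [extDirectSumMap_of, extMap_extMap]
      by_cases hij : j = i
      · subst hij
        have : DirectSum.component S I Z j ∘ₗ DirectSum.lof S I Z j = LinearMap.id :=
          LinearMap.ext fun x => DirectSum.component.lof_self S j x
        rw [this, extMap_id, DirectSum.of_eq_same]
      · have : DirectSum.component S I Z i ∘ₗ DirectSum.lof S I Z j = 0 :=
          LinearMap.ext fun x => DirectSum.of_eq_of_ne j i x (Ne.symm hij)
        rw [this, extMap_zero]
        exact (DirectSum.of_eq_of_ne (β := fun i => ExtGroup S M n (Z i)) j i x (Ne.symm hij)).symm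
    | add x y hx hy => rw [map_add, map_add, hx, hy, DirectSum.add_apply]
  intro z w hzw
  refine DFinsupp.ext fun i => ?_
  rw [← key i z, ← key i w, hzw]

theorem exists_subtype_eq_sum_of_fg {N : Submodule S (DirectSum I Z)} (hN : N.FG) :
    ∃ J : Finset I, N.subtype =
      ∑ i ∈ J, DirectSum.lof S I Z i ∘ₗ DirectSum.component S I Z i ∘ₗ N.subtype := by
  classical
  obtain ⟨T, rfl⟩ := hN
  have key : ∀ x : DirectSum I Z, x ∈ Submodule.span S (T : Set (DirectSum I Z)) →
      ∀ i ∉ T.biUnion DFinsupp.support, x i = 0 := by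
    intro x hx i hi
    have : Submodule.span S (T : Set (DirectSum I Z)) ≤
        LinearMap.ker (DirectSum.component S I Z i) := Submodule.span_le.2 fun y hy => by
      by_contra h
      exact hi (Finset.mem_biUnion.2 ⟨y, hy, DFinsupp.mem_support_iff.2 h⟩)
    exact this hx
  refine ⟨T.biUnion DFinsupp.support, LinearMap.ext fun x => ?_⟩
  refine DFinsupp.ext fun i => ?_
  rw [LinearMap.sum_apply]
  change x.1 i = DirectSum.component S I Z i _
  rw [map_sum]
  by_cases hi : i ∈ T.biUnion DFinsupp.support
  · rw [Finset.sum_eq_single_of_mem i hi]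
    · exact (DirectSum.component.lof_self S i (x.1 i)).symm
    · intro j _ hj
      exact DirectSum.of_eq_of_ne j i (x.1 j) hj.symm
  · rw [key x x.2 i hi, Finset.sum_eq_zero]
    intro j hj
    exact DirectSum.of_eq_of_ne j i (x.1 j) fun h => hi (h ▸ hj)

end

/-- `X` is the direct limit of its finitely generated submodules. -/
theorem ExtCommutesWithDirectLimits.exists_extMap_subtype {n : ℕ}
    (h : ExtCommutesWithDirectLimits S M n) (y : ExtGroup S M n X) :
    ∃ N : Submodule S X, N.FG ∧ ∃ x : ExtGroup S M n N, extMap S M n N.subtype x = y := by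
  classical
  let e := Module.fgSystem.equiv S X
  have hb := h {N : Submodule S X // N.FG} (fun N => N.1) (Module.fgSystem S X)
  obtain ⟨z, hz⟩ := hb.2 (extMap S M n e.symm.toLinearMap y)
  induction z using AddCommGroup.DirectLimit.induction_on with
  | ih N x =>
    refine ⟨N.1, N.2, x, ?_⟩
    have hx : extMap S M n (Module.DirectLimit.of S _ _ (Module.fgSystem S X) N) x =
        extMap S M n e.symm.toLinearMap y :=
      (extDirectLimitMap_of n (fun N : {N : Submodule S X // N.FG} => N.1)
        (Module.fgSystem S X) N x).symm.trans hz
    have := congrArg (extMap S M n e.toLinearMap) hx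
    rwa [extMap_extMap, extMap_extMap, Module.fgSystem.equiv_comp_of, LinearEquiv.comp_symm,
      extMap_id] at this

/-- A class comes from a finitely generated submodule `N`. The inclusion of `N` is a finite sum of
maps through single coordinates, so additivity of `Ext` in the map gives a preimage. -/
theorem ExtCommutesWithDirectLimits.directSumsOfCopies {n : ℕ}
    (h : ExtCommutesWithDirectLimits S M n) (A : Type u) [AddCommGroup A] [Module S A] :
    ExtCommutesWithDirectSumsOfCopies S M n A := by
  intro I _
  refine ⟨extDirectSumMap_injective _ n, fun y => ?_⟩
  obtain ⟨N, hN, x, rfl⟩ := h.exists_extMap_subtype y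
  obtain ⟨J, hJ⟩ := exists_subtype_eq_sum_of_fg _ hN
  have hw : ∀ i : I, extDirectSumMap S M n (fun _ : I => A)
      (DirectSum.of (fun _ : I => ExtGroup S M n A) i
        (extMap S M n (DirectSum.component S I (fun _ => A) i ∘ₗ N.subtype) x)) =
      extMap S M n (DirectSum.lof S I (fun _ => A) i ∘ₗ
        DirectSum.component S I (fun _ => A) i ∘ₗ N.subtype) x := fun i => by
    rw [extDirectSumMap_of, extMap_extMap]
  have hs : extMap S M n N.subtype x =
      ∑ i ∈ J, extMap S M n (DirectSum.lof S I (fun _ => A) i ∘ₗ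
        DirectSum.component S I (fun _ => A) i ∘ₗ N.subtype) x :=
    (congrArg (fun f => extMap S M n f x) hJ).trans (extMap_sum n J _ x)
  rw [hs, ← Finset.sum_congr rfl fun i _ => hw i, ← map_sum]
  exact ⟨_, rfl⟩

end DirectSum

/-! ### From direct sums of copies back to a finitely generated syzygy -/

section Copies

variable {S : Type u} [Ring S] {M : Type u} [AddCommGroup M] [Module S M]
  {A : Type u} [AddCommGroup A] [Module S A]

/-- Every class in `Ext¹(M, ⨁ i, A)` is, up to a homomorphism extending to `P`, represented by a
homomorphism `ker p → ⨁ i, A` with values in a finite subsum. -/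
theorem ExtCommutesWithDirectSumsOfCopies.exists_extension
    (h : ExtCommutesWithDirectSumsOfCopies S M 1 A) {P : Type u} [AddCommGroup P] [Module S P]
    [Module.Projective S P] {p : P →ₗ[S] M} (hp : Function.Surjective p) {I : Type u}
    [DecidableEq I] (f : LinearMap.ker p →ₗ[S] DirectSum I fun _ => A) :
    ∃ (J : Finset I) (g : P →ₗ[S] DirectSum I fun _ => A),
      ∀ k : LinearMap.ker p, ∀ i ∉ J, g k i = f k i := by
  classical
  obtain ⟨z, hz⟩ := (h I).2 (connecting hp f)
  -- If `φ` represents the same class as `f` and vanishes off `J`, then `f - φ` extends to `P` and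
  -- agrees with `f` off `J`.
  suffices hs : ∀ z : DirectSum I fun _ => ExtGroup S M 1 A, ∃ (J : Finset I)
      (φ : LinearMap.ker p →ₗ[S] DirectSum I fun _ => A),
      extDirectSumMap S M 1 (fun _ => A) z = connecting hp φ ∧ ∀ k, ∀ i ∉ J, φ k i = 0 by
    obtain ⟨J, φ, h1, h2⟩ := hs z
    have h3 : connecting hp (f - φ) = 0 := by
      have := connecting_add hp (f - φ) φ
      rw [sub_add_cancel, ← hz, h1] at this
      exact right_eq_add.1 this
    obtain ⟨g, hg⟩ := (connecting_eq_zero_iff hp _).1 h3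
    refine ⟨J, g, fun k i hi => ?_⟩
    have h4 : g k = f k - φ k := LinearMap.congr_fun hg k
    rw [h4, DirectSum.sub_apply, h2 k i hi, sub_zero]
  intro z
  induction z using DirectSum.induction_on with
  | zero =>
    exact ⟨∅, 0, by
      rw [map_zero, (connecting_eq_zero_iff hp _).2 ⟨0, LinearMap.zero_comp _⟩], fun _ _ _ => rfl⟩
  | of i x =>
    obtain ⟨φ, rfl⟩ := connecting_surjective hp x
    refine ⟨{i}, DirectSum.lof S I (fun _ => A) i ∘ₗ φ, ?_, fun k j hj => ?_⟩
    · rw [extDirectSumMap_of, extMap_connecting]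
    · exact DirectSum.of_eq_of_ne _ _ _ fun h => hj (Finset.mem_singleton.2 h)
  | add z w hz hw =>
    obtain ⟨J, φ, h1, h2⟩ := hz
    obtain ⟨J', φ', h1', h2'⟩ := hw
    refine ⟨J ∪ J', φ + φ', by rw [map_add, h1, h1', connecting_add], fun k i hi => ?_⟩
    rw [Finset.notMem_union] at hi
    rw [LinearMap.add_apply, DirectSum.add_apply, h2 k i hi.1, h2' k i hi.2, add_zero]

/-- Let `f` be a split embedding of the kernel of `p` into a projective module `E`, and `q` a
surjection from `E` to a projective module with finitely generated kernel. If `q ∘ f` extends to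
`P` through `E`, then `M` is the quotient of a projective module by a finitely generated one. -/
theorem HasFiniteProjectiveSyzygy.of_extension
    (hM : HasProjectiveDimensionLE (ModuleCat.of S M) 1) {P E D G : Type u}
    [AddCommGroup P] [Module S P] [AddCommGroup E] [Module S E] [AddCommGroup D] [Module S D]
    [AddCommGroup G] [Module S G] [Module.Projective S P] [Module.Projective S E]
    [Module.Projective S D] [Module.Finite S G] {p : P →ₗ[S] M} (hp : Function.Surjective p)
    (f : LinearMap.ker p →ₗ[S] E) (r : E →ₗ[S] LinearMap.ker p) (hr : ∀ k, r (f k) = k)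
    (q : E →ₗ[S] D) (hq : Function.Surjective q) (c : G →ₗ[S] E)
    (hc : LinearMap.range c = LinearMap.ker q)
    (g : P →ₗ[S] E) (hg : ∀ k : LinearMap.ker p, q (g k) = q (f k)) :
    HasFiniteProjectiveSyzygy S M := by
  have hrs : Function.Surjective r := fun k => ⟨f k, hr k⟩
  have hK : Module.Projective S (LinearMap.ker p) :=
    projective_ker_of_hasProjectiveDimensionLE hM p hp
  have hL : Module.Projective S (LinearMap.ker r) := projective_ker_of_projective r hrs
  -- Under `ker p × ker r ≃ E`, the map `t` extends `q` to `P × ker r`. It is already onto on that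
  -- submodule, so any element of `P × ker r` can be corrected into `ker t` without changing its
  -- image in `M`.
  let t : (P × LinearMap.ker r) →ₗ[S] D := (q ∘ₗ g).coprod (q ∘ₗ (LinearMap.ker r).subtype)
  have htk : ∀ (k : LinearMap.ker p) (l : LinearMap.ker r), t (k, l) = q (f k + l) := fun k l => by
    simp [t, hg]
  have hE : ∀ x : E, ∃ (k : LinearMap.ker p) (l : LinearMap.ker r), f k + l = x := fun x =>
    ⟨r x, ⟨x - f (r x), by simp [hr]⟩, by simp⟩
  have hker : ∀ y : D, ∃ (k : LinearMap.ker p) (l : LinearMap.ker r), t (k, l) = y := fun y => by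
    obtain ⟨x, rfl⟩ := hq y
    obtain ⟨k, l, rfl⟩ := hE x
    exact ⟨k, l, htk k l⟩
  have ht : Function.Surjective t := fun y => by
    obtain ⟨k, l, h⟩ := hker y
    exact ⟨_, h⟩
  have hV : Module.Projective S (LinearMap.ker t) := projective_ker_of_projective t ht
  let p' : LinearMap.ker t →ₗ[S] M := p ∘ₗ LinearMap.fst S P _ ∘ₗ (LinearMap.ker t).subtype
  have hp' : Function.Surjective p' := fun m => by
    obtain ⟨a, rfl⟩ := hp m
    obtain ⟨k, l, h⟩ := hker (t (a, 0))
    refine ⟨⟨(a, 0) - ((k : P), l), by rw [LinearMap.mem_ker, map_sub, h, sub_self]⟩, ?_⟩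
    have hk : p k = 0 := k.2
    simp [p', hk]
  refine ⟨LinearMap.ker t, _, _, p', hV, hp',
    projective_ker_of_hasProjectiveDimensionLE hM p' hp', ?_⟩
  -- `b` identifies `E` with `ker p × ker r` and carries `q` to `t`; hence the kernel of `p'` is the
  -- image of `ker q = range c`.
  let b : E →ₗ[S] P × LinearMap.ker r :=
    ((LinearMap.ker p).subtype ∘ₗ r).prod
      ((LinearMap.id - f ∘ₗ r).codRestrict (LinearMap.ker r) fun x => by simp [hr])
  have htb : ∀ x, t (b x) = q x := fun x => by
    refine (htk (r x) _).trans ?_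
    simp
  let w : G →ₗ[S] LinearMap.ker p' :=
    ((b ∘ₗ c).codRestrict (LinearMap.ker t) fun x => by
      rw [LinearMap.mem_ker, LinearMap.comp_apply, htb]
      exact LinearMap.mem_ker.1 (hc ▸ LinearMap.mem_range_self c x)).codRestrict
        (LinearMap.ker p') fun x => (r (c x)).2
  refine Module.Finite.of_surjective w ?_
  rintro ⟨⟨⟨a, l⟩, hal⟩, ha⟩
  have ha' : a ∈ LinearMap.ker p := ha
  have h0 : f ⟨a, ha'⟩ + l ∈ LinearMap.range c := by
    rw [hc, LinearMap.mem_ker, ← htk]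
    exact hal
  obtain ⟨x, hx⟩ := h0
  have hl : r l = 0 := l.2
  have h1 : r (c x) = ⟨a, ha'⟩ := by rw [hx, map_add, hr, hl, add_zero]
  refine ⟨x, Subtype.ext (Subtype.ext (Prod.ext ?_ (Subtype.ext ?_)))⟩
  · exact congrArg Subtype.val h1
  · change c x - f (r (c x)) = l
    rw [h1, hx, add_sub_cancel_left]

/-- The hypothesis is applied with the underlying set of `ker p` as index set, to the class of the
splitting `s` of the free cover of `ker p`. The map `q` forgets the coordinates in `J`, so its
kernel is free of finite rank. -/
theorem HasFiniteProjectiveSyzygy.of_extCommutesWithDirectSumsOfCopies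
    (hM : HasProjectiveDimensionLE (ModuleCat.of S M) 1) (e : S ≃ₗ[S] A)
    (h : ExtCommutesWithDirectSumsOfCopies S M 1 A) : HasFiniteProjectiveSyzygy S M := by
  classical
  let p : (M →₀ S) →ₗ[S] M := Finsupp.linearCombination S id
  have hp : Function.Surjective p := Finsupp.linearCombination_id_surjective S M
  have hK : Module.Projective S (LinearMap.ker p) :=
    projective_ker_of_hasProjectiveDimensionLE hM p hp
  obtain ⟨s, hs⟩ := Module.projective_def'.1 hK
  let d : (LinearMap.ker p →₀ S) ≃ₗ[S] DirectSum (LinearMap.ker p) fun _ => A :=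
    (Finsupp.mapRange.linearEquiv e).trans (finsuppLEquivDirectSum S A (LinearMap.ker p))
  have hd : ∀ x i, d x i = e (x i) := fun x i => rfl
  obtain ⟨J, g, hg⟩ := h.exists_extension hp (d.toLinearMap ∘ₗ s)
  have hfin : Module.Finite S (Finsupp.supported S S (J : Set (LinearMap.ker p))) :=
    Module.Finite.equiv (Finsupp.supportedEquivFinsupp (J : Set (LinearMap.ker p))).symm
  refine HasFiniteProjectiveSyzygy.of_extension
    (G := Finsupp.supported S S (J : Set (LinearMap.ker p))) hM hp s (Finsupp.linearCombination S id)
    (fun k => LinearMap.congr_fun hs k)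
    (Finsupp.lsubtypeDomain ((J : Set (LinearMap.ker p))ᶜ)) ?_
    (Finsupp.supported S S (J : Set (LinearMap.ker p))).subtype ?_
    (d.symm.toLinearMap ∘ₗ g) ?_
  · intro y
    refine ⟨Finsupp.mapDomain Subtype.val y, ?_⟩
    ext i
    exact Finsupp.mapDomain_apply Subtype.val_injective y i
  · rw [Submodule.range_subtype]
    ext x
    rw [Finsupp.mem_supported', LinearMap.mem_ker]
    exact ⟨fun hx => Finsupp.ext fun i => hx i i.2,
      fun hx i hi => DFunLike.congr_fun hx (⟨i, hi⟩ : ((J : Set (LinearMap.ker p))ᶜ : Set _))⟩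
  · intro k
    ext ⟨i, hi⟩
    have h1 : ∀ x, e ((d.symm x) i) = x i := fun x => by rw [← hd, d.apply_symm_apply]
    exact e.injective ((h1 (g k)).trans ((hg k i hi).trans (hd _ _)))

end Copies

end ExtColim

theorem theorem2p4 (R : Type u) [Ring R] (M : Type u) [AddCommGroup M] [Module Rᵐᵒᵖ M]
    (hM : HasProjectiveDimensionLE (ModuleCat.of Rᵐᵒᵖ M) 1) :
    List.TFAE [
      ExtColim.IsFpOmegaOne Rᵐᵒᵖ M,
      ExtColim.IsStablyFPPlusProjective Rᵐᵒᵖ M 2,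
      ExtColim.IsStablyFPPlusProjective Rᵐᵒᵖ M 1,
      ExtColim.ExtCommutesWithDirectLimits Rᵐᵒᵖ M 1,
      ExtColim.ExtCommutesWithDirectSumsOfCopies Rᵐᵒᵖ M 1 R] := by
  -- The free modules in the argument are sums of `Rᵐᵒᵖ`, while the last condition concerns the
  -- right module `R`.
  have e : Rᵐᵒᵖ ≃ₗ[Rᵐᵒᵖ] R :=
    { MulOpposite.opAddEquiv.symm with map_smul' := fun _ _ => rfl }
  tfae_have 1 → 2 := fun h =>
    (ExtColim.HasFiniteProjectiveSyzygy.of_isFpOmegaOne hM h).isStablyFPPlusProjective 2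
  tfae_have 2 → 3 := ExtColim.isStablyFPPlusProjective_mono one_le_two
  tfae_have 3 → 4 := fun h =>
    (ExtColim.HasFiniteProjectiveSyzygy.of_isStablyFPPlusProjective hM
      h).extCommutesWithDirectLimits
  tfae_have 4 → 5 := fun h => h.directSumsOfCopies R
  tfae_have 5 → 1 := fun h =>
    (ExtColim.HasFiniteProjectiveSyzygy.of_extCommutesWithDirectSumsOfCopies hM e h).isFpOmegaOne
  tfae_finish
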